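/- Let $H$ be a real Hilbert space and let $Q\colon H\to H$ be monotone ($\langle Q(u)-Q(v),u-v\rangle\ge 0$ for all $u,v\in H$) and Lipschitz continuous, with $\operatorname{zer}Q:=\{z\in H: Q(z)=0\}\neq\emptyset$; let $x^*\in\operatorname{zer}Q$. Let $t_0>0$, $\alpha\ge 2$, $\eta\in(0,1)$, $\varepsilon\ge 0$, and let $\beta\colon[t_0,+\infty)\to(0,+\infty)$ be differentiable and satisfy the growth condition $$0\le \frac{\dot\beta(t)\,t}{\beta(t)}\le \alpha-2-\varepsilon\qquad\text{for all } t\ge t_0 .$$ Put $\theta:=(1-\eta)+\eta(\alpha-1)$ and $b(t):=(1-\eta)\dot\beta(t)+\theta\,\beta(t)/t$. Let $x\colon[t_0,+\infty)\to H$ be a strong solution of $$\ddot x(t)+\frac{\alpha}{t}\dot x(t)+\beta(t)\frac{d}{dt}Q(x(t))+b(t)Q(x(t))=0,\qquad t\ge t_0,$$ that is, $x$ is differentiable, $x$ and $\dot x$ are locally absolutely continuous on $[t_0,+\infty)$, and for almost every $t\ge t_0$ the derivatives $\ddot x(t)$ and $\frac{d}{dt}Q(x(t))$ exist and satisfy the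 equation. Then, as $t\to+\infty$, $$\langle Q(x(t)),x(t)-x^*\rangle=\mathcal O\!\left(\frac1{t\beta(t)}\right)\quad\text{and}\quad \|Q(x(t))\|=\mathcal O\!\left(\frac1{t\beta(t)}\right).$$ If, additionally, $\alpha>2$ and $\varepsilon>0$, then: (i) $\displaystyle\int_{t_0}^{\infty}\beta(t)\langle Q(x(t)),x(t)-x^*\rangle\,dt<+\infty$, $\displaystyle\int_{t_0}^{\infty}t\,\beta(t)^2\|Q(x(t))\|^2\,dt<+\infty$, and $\displaystyle\int_{t_0}^{\infty}t\,\|\dot x(t)\|^2\,dt<+\infty$; (ii) $x(t)$ converges weakly to a zero of $Q$ as $t\to+\infty$; (iii) as $t\to+\infty$, $$\langle Q(x(t)),x(t)-x^*\rangle=o\!\left(\frac1{t\beta(t)}\right),\qquad \|Q(x(t))\|=o\!\left(\frac1{t\beta(t)}\right),\qquad \|\dot x(t)\|=o\!\left(\frac1t\right).$$ -/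

import Mathlib

open Set Filter Topology MeasureTheory Asymptotics
open scoped RealInnerProductSpace NNReal

/-- Monotonicity of a single-valued operator `Q : H → H` on a real inner product space. -/
def IsMonotoneOperator {H : Type*} [NormedAddCommGroup H] [InnerProductSpace ℝ H]
    (Q : H → H) : Prop :=
  ∀ u v : H, 0 ≤ ⟪Q u - Q v, u - v⟫

/-- The derivative of a curve on the half-line `[t₀, ∞)`: one-sided at `t₀` and the usual
derivative at every `t > t₀`. -/
noncomputable def dot {E : Type*} [NormedAddCommGroup E] [NormedSpace ℝ E]
    (t₀ : ℝ) (f : ℝ → E) (t : ℝ) : E :=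
  derivWithin f (Ici t₀) t

/-- Local absolute continuity on `[t₀, ∞)`: absolute continuity on every `[t₀, T]`. -/
def LocallyAC {E : Type*} [NormedAddCommGroup E] (t₀ : ℝ) (f : ℝ → E) : Prop :=
  ∀ T : ℝ, t₀ ≤ T → AbsolutelyContinuousOnInterval f t₀ T

/-- The parameter `θ = (1 - η) + η (α - 1)`. -/
def theta (α η : ℝ) : ℝ := (1 - η) + η * (α - 1)

/-- The coefficient `b(t) = (1 - η) β'(t) + θ β(t) / t`. -/
noncomputable def bCoeff (t₀ α η : ℝ) (β : ℝ → ℝ) (t : ℝ) : ℝ :=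
  (1 - η) * dot t₀ β t + theta α η * (β t / t)

/-- `x` is a strong (global) solution on `[t₀, ∞)` of
`x'' + (α / t) x' + β(t) d/dt Q(x(t)) + b(t) Q(x(t)) = 0`: `x` and `x'` are locally absolutely
continuous on `[t₀, ∞)`, and for almost every `t` the derivatives `x''(t)` and `d/dt Q(x(t))` exist
and satisfy the equation. Only the values of `x` on `[t₀, ∞)` matter. -/
structure IsStrongSolution {H : Type*} [NormedAddCommGroup H] [InnerProductSpace ℝ H]
    (Q : H → H) (t₀ α η : ℝ) (β : ℝ → ℝ) (x : ℝ → H) : Prop where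
  differentiableOn : DifferentiableOn ℝ x (Ici t₀)
  locallyAC : LocallyAC t₀ x
  locallyAC_dot : LocallyAC t₀ (dot t₀ x)
  equation : ∀ᵐ t ∂(volume.restrict (Ici t₀)),
    DifferentiableAt ℝ (dot t₀ x) t ∧ DifferentiableAt ℝ (fun s => Q (x s)) t ∧
      deriv (dot t₀ x) t + (α / t) • dot t₀ x t + β t • deriv (fun s => Q (x s)) t
        + bCoeff t₀ α η β t • Q (x t) = 0

/-- The growth condition `0 ≤ t β'(t) / β(t) ≤ α - 2 - ε` for all `t ≥ t₀`. -/
def GrowthCondition (t₀ α ε : ℝ) (β : ℝ → ℝ) : Prop :=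
  ∀ t : ℝ, t₀ ≤ t → 0 ≤ dot t₀ β t * t / β t ∧ dot t₀ β t * t / β t ≤ α - 2 - ε

/-!
Write `y = x - x*`, `v = x'`, `q = Q x`. The proof rests on a family of Lyapunov functions that is
affine in a parameter `lam`: `E lam = kineticEnergy + lam * coupling`, where

* `kineticEnergy = ½ ‖t v + (1 - η) t β q‖² + ½ η (1 - η) ‖t β q‖²`,
* `coupling = ⟪y, t v + t β q⟫ + ½ (α - 1) ‖y‖²`.

Completing the square (`kineticEnergy_add_coupling`) gives
`E lam = ½ ‖lam y + t v + (1 - η) t β q‖² + ½ lam (α - 1 - lam) ‖y‖² + η lam t β ⟪q, y⟫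
+ ½ η (1 - η) ‖t β q‖²`, and along a solution (`hasDerivAt_lyapunov`)
`E' = -(α - 1 - lam) (t ‖v‖² + t β ⟪v, q⟫)
- ((α - 2) β - t β') (η (1 - η) t β ‖q‖² + η lam ⟪q, y⟫) - η t² β ⟪v, q'⟫`.
Monotonicity makes `⟪v, q'⟫` nonnegative, and the growth condition bounds `(α - 2) β - t β'` below
by `ε β`. As the growth condition also makes `β` locally Lipschitz, `E` is locally absolutely
continuous and the almost everywhere estimate integrates (`DampedMonotoneFlow.lyapunov_sub_le`).

For `lam = α - 1` the function `E` is nonincreasing, which bounds `t β ⟪q, y⟫` and `t β ‖q‖`; if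
`ε > 0` it also yields the integrability of `β ⟪q, y⟫` and `t β² ‖q‖²`. For `lam = 0` the cross term
is absorbed by the integrable `t β² ‖q‖²`, so `t ‖v‖²` is integrable and the kinetic energy
converges. Its quotient by `t` is integrable, hence its limit is `0`
(`DampedMonotoneFlow.tendsto_kineticEnergy`), that is `t v → 0` and `t β q → 0`. The coupling term,
a difference quotient of two convergent functions, converges too. Since its inner product part
vanishes in the limit, `y` is bounded and `‖y‖²` converges, for every zero of `Q` in place of `x*`.
This gives the little-o rates, and Opial's lemma (`exists_weak_limit_of_opial`) together with
Minty's argument (`IsMonotoneOperator.eq_zero_of_weak_limit`) gives the weak convergence.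
-/

/-! ### Locally absolutely continuous functions -/

section AbsoluteContinuity

variable {E F : Type*} [NormedAddCommGroup E] [NormedAddCommGroup F]

theorem AbsolutelyContinuousOnInterval.lipschitz_comp {a b : ℝ} {f : ℝ → E}
    (hf : AbsolutelyContinuousOnInterval f a b) {K : ℝ≥0} {g : E → F} (hg : LipschitzWith K g) :
    AbsolutelyContinuousOnInterval (fun t => g (f t)) a b := by
  unfold AbsolutelyContinuousOnInterval at hf ⊢
  refine squeeze_zero (fun _ => Finset.sum_nonneg fun _ _ => dist_nonneg) (fun I => ?_)
    (by simpa using hf.const_mul (K : ℝ))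
  rw [Finset.mul_sum]
  exact Finset.sum_le_sum fun i _ => hg.dist_le_mul _ _

variable {t₀ : ℝ}

theorem LocallyAC.lipschitz_comp {f : ℝ → E} (hf : LocallyAC t₀ f) {K : ℝ≥0} {g : E → F}
    (hg : LipschitzWith K g) : LocallyAC t₀ (fun t => g (f t)) :=
  fun T hT => (hf T hT).lipschitz_comp hg

theorem LocallyAC.continuousOn {f : ℝ → E} (hf : LocallyAC t₀ f) : ContinuousOn f (Ici t₀) := by
  intro t ht
  have ht' : t₀ ≤ t + 1 := by have : t₀ ≤ t := ht; linarith
  have h := (hf (t + 1) ht').continuousOn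
  rw [uIcc_of_le ht'] at h
  refine (h t ⟨ht, by linarith⟩).mono_of_mem_nhdsWithin ?_
  filter_upwards [self_mem_nhdsWithin, mem_nhdsWithin_of_mem_nhds (Iio_mem_nhds (lt_add_one t))]
    with s hs hs'
  exact ⟨hs, le_of_lt hs'⟩

theorem LocallyAC.add {f g : ℝ → E} (hf : LocallyAC t₀ f) (hg : LocallyAC t₀ g) :
    LocallyAC t₀ (fun t => f t + g t) :=
  fun T hT => (hf T hT).fun_add (hg T hT)

theorem LocallyAC.sub {f g : ℝ → E} (hf : LocallyAC t₀ f) (hg : LocallyAC t₀ g) :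
    LocallyAC t₀ (fun t => f t - g t) :=
  fun T hT => (hf T hT).fun_sub (hg T hT)

theorem LocallyAC.const (c : E) : LocallyAC t₀ (fun _ => c) :=
  fun _ _ => (LipschitzWith.const c).lipschitzOnWith.absolutelyContinuousOnInterval

theorem LocallyAC.id : LocallyAC t₀ (fun t : ℝ => t) :=
  fun _ _ => LipschitzWith.id.lipschitzOnWith.absolutelyContinuousOnInterval

theorem LocallyAC.smul [NormedSpace ℝ E] {f : ℝ → ℝ} {g : ℝ → E} (hf : LocallyAC t₀ f)
    (hg : LocallyAC t₀ g) : LocallyAC t₀ (fun t => f t • g t) :=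
  fun T hT => (hf T hT).fun_smul (hg T hT)

theorem LocallyAC.mul {f g : ℝ → ℝ} (hf : LocallyAC t₀ f) (hg : LocallyAC t₀ g) :
    LocallyAC t₀ (fun t => f t * g t) :=
  hf.smul hg

theorem LocallyAC.norm_sq {f : ℝ → E} (hf : LocallyAC t₀ f) :
    LocallyAC t₀ (fun t => ‖f t‖ ^ 2) := by
  have h : LocallyAC t₀ (fun t => ‖f t‖) := hf.lipschitz_comp lipschitzWith_one_norm
  simpa only [sq] using h.mul h

theorem LocallyAC.inner [InnerProductSpace ℝ E] {f g : ℝ → E} (hf : LocallyAC t₀ f)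
    (hg : LocallyAC t₀ g) : LocallyAC t₀ (fun t => ⟪f t, g t⟫) := by
  have h := (LocallyAC.const (t₀ := t₀) (1 / 2 : ℝ)).mul
    (((hf.add hg).norm_sq.sub hf.norm_sq).sub hg.norm_sq)
  refine (funext fun t => ?_ : (fun t => ⟪f t, g t⟫) = _) ▸ h
  rw [norm_add_sq_real]
  ring

/-- A differentiable function whose derivative is bounded on every `[t₀, T]` is locally Lipschitz,
so absolutely continuous there even if the derivative is discontinuous. -/
theorem LocallyAC.of_bounded_dot {f : ℝ → ℝ} (hf : DifferentiableOn ℝ f (Ici t₀))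
    (hb : ∀ T, t₀ ≤ T → ∃ C : ℝ, ∀ t ∈ Icc t₀ T, |dot t₀ f t| ≤ C) : LocallyAC t₀ f := by
  intro T hT
  obtain ⟨C, hC⟩ := hb T hT
  have h : LipschitzOnWith C.toNNReal f (Icc t₀ T) := by
    refine (convex_Icc t₀ T).lipschitzOnWith_of_nnnorm_hasDerivWithin_le
      (f' := dot t₀ f) (fun t ht => ?_) (fun t ht => ?_)
    · exact ((hf t ht.1).hasDerivWithinAt).mono Icc_subset_Ici_self
    · rw [← NNReal.coe_le_coe, coe_nnnorm, Real.norm_eq_abs]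
      exact (hC t ht).trans (Real.le_coe_toNNReal C)
  exact LipschitzOnWith.absolutelyContinuousOnInterval (by rwa [uIcc_of_le hT])

end AbsoluteContinuity

/-! ### Differential inequalities and limits of scalar functions -/

/-- For a locally absolutely continuous function an almost everywhere bound on the derivative
integrates. -/
theorem LocallyAC.sub_le_integral {t₀ : ℝ} {f g : ℝ → ℝ} (hf : LocallyAC t₀ f)
    (hg : ContinuousOn g (Ici t₀))
    (hfg : ∀ᵐ t ∂(volume.restrict (Ici t₀)), deriv f t ≤ g t) {s t : ℝ} (hs : t₀ ≤ s)
    (hst : s ≤ t) : f t - f s ≤ ∫ τ in s..t, g τ := by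
  have hac : AbsolutelyContinuousOnInterval f s t := by
    refine (hf t (hs.trans hst)).mono ?_
    rw [uIcc_of_le hst, uIcc_of_le (hs.trans hst)]
    exact Icc_subset_Icc_left hs
  have hsub : Icc s t ⊆ Ici t₀ := fun τ hτ => hs.trans hτ.1
  rw [← hac.integral_deriv_eq_sub]
  refine intervalIntegral.integral_mono_ae_restrict hst hac.intervalIntegrable_deriv
    ((hg.mono hsub).intervalIntegrable_of_Icc hst) ?_
  exact ae_mono (Measure.restrict_mono hsub le_rfl) hfg

/-- A continuous nonnegative dissipation rate of a nonnegative energy, up to an integrable source,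
is integrable. -/
theorem integrableOn_Ici_of_dissipation {t₀ : ℝ} {f g h : ℝ → ℝ}
    (hf0 : ∀ t, t₀ ≤ t → 0 ≤ f t) (hg : ContinuousOn g (Ici t₀)) (hg0 : ∀ t, t₀ ≤ t → 0 ≤ g t)
    (hh : ContinuousOn h (Ici t₀)) (hhi : IntegrableOn h (Ici t₀)) (hh0 : ∀ t, t₀ ≤ t → 0 ≤ h t)
    (hfg : ∀ t, t₀ ≤ t → f t - f t₀ ≤ ∫ τ in t₀..t, (h τ - g τ)) : IntegrableOn g (Ici t₀) := by
  rw [integrableOn_Ici_iff_integrableOn_Ioi]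
  have hint : ∀ {k : ℝ → ℝ}, ContinuousOn k (Ici t₀) → ∀ t, t₀ ≤ t →
      IntervalIntegrable k volume t₀ t :=
    fun hk t ht => (hk.mono Icc_subset_Ici_self).intervalIntegrable_of_Icc ht
  refine integrableOn_Ioi_of_intervalIntegral_norm_bounded (l := atTop) (b := fun t : ℝ => t)
    (f t₀ + ∫ τ in Ioi t₀, h τ) t₀ (fun t => ?_) tendsto_id ?_
  · rcases le_total t₀ t with ht | ht
    · exact (intervalIntegrable_iff_integrableOn_Ioc_of_le ht).1 (hint hg t ht)
    · simp [Ioc_eq_empty_of_le ht]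
  · filter_upwards [eventually_ge_atTop t₀] with t ht
    have h1 : ∫ τ in t₀..t, ‖g τ‖ = ∫ τ in t₀..t, g τ := by
      refine intervalIntegral.integral_congr fun τ hτ => ?_
      rw [uIcc_of_le ht] at hτ
      exact Real.norm_of_nonneg (hg0 τ hτ.1)
    have h2 := hfg t ht
    rw [intervalIntegral.integral_sub (hint hh t ht) (hint hg t ht)] at h2
    have h3 : ∫ τ in t₀..t, h τ ≤ ∫ τ in Ioi t₀, h τ := by
      rw [intervalIntegral.integral_of_le ht]
      refine setIntegral_mono_set (hhi.mono_set Ioi_subset_Ici_self) ?_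
        (LE.le.eventuallyLE Ioc_subset_Ioi_self)
      exact (ae_restrict_iff' measurableSet_Ioi).2 (Eventually.of_forall fun τ hτ => hh0 τ hτ.le)
    linarith [hf0 t ht]

/-- A nonnegative function that grows no faster than the integral of an integrable function
converges. -/
theorem exists_tendsto_of_sub_le_integral {t₀ : ℝ} {f h : ℝ → ℝ}
    (hf0 : ∀ t, t₀ ≤ t → 0 ≤ f t) (hh : ContinuousOn h (Ici t₀)) (hhi : IntegrableOn h (Ici t₀))
    (hfh : ∀ s t, t₀ ≤ s → s ≤ t → f t - f s ≤ ∫ τ in s..t, h τ) :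
    ∃ L, Tendsto f atTop (𝓝 L) := by
  have hint : ∀ s t, t₀ ≤ s → s ≤ t → IntervalIntegrable h volume s t := fun s t hs hst =>
    (hh.mono fun τ hτ => hs.trans hτ.1).intervalIntegrable_of_Icc hst
  have hI : Tendsto (fun t => ∫ τ in t₀..t, h τ) atTop (𝓝 (∫ τ in Ioi t₀, h τ)) :=
    intervalIntegral_tendsto_integral_Ioi t₀ (hhi.mono_set Ioi_subset_Ici_self) tendsto_id
  obtain ⟨M, hM⟩ : ∃ M, ∀ t, t₀ ≤ t → ∫ τ in t₀..t, h τ ≤ M := by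
    refine ⟨∫ τ in Ioi t₀, ‖h τ‖, fun t ht => ?_⟩
    rw [intervalIntegral.integral_of_le ht]
    have hn : IntegrableOn (fun τ => ‖h τ‖) (Ioi t₀) :=
      (hhi.mono_set Ioi_subset_Ici_self).norm
    refine (le_abs_self _).trans ((norm_integral_le_integral_norm h).trans ?_)
    exact setIntegral_mono_set hn (Eventually.of_forall fun _ => norm_nonneg _)
      (LE.le.eventuallyLE Ioc_subset_Ioi_self)
  -- Freezing the argument at `t₀` below `t₀` makes the function antitone on the whole line.
  let G : ℝ → ℝ := fun t => f (max t₀ t) - ∫ τ in t₀..(max t₀ t), h τ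
  have hG : Antitone G := by
    intro s t hst
    have hs : t₀ ≤ max t₀ s := le_max_left _ _
    have hst' : max t₀ s ≤ max t₀ t := max_le_max_left _ hst
    have h1 := hfh _ _ hs hst'
    have h2 := intervalIntegral.integral_add_adjacent_intervals (hint _ _ le_rfl hs)
      (hint _ _ hs hst')
    simp only [G]
    linarith
  have hGb : BddBelow (range G) := by
    refine ⟨-M, ?_⟩
    rintro _ ⟨t, rfl⟩
    have := hf0 _ (le_max_left t₀ t)
    have := hM _ (le_max_left t₀ t)
    simp only [G]
    linarith
  refine ⟨_, ((tendsto_atTop_ciInf hG hGb).add hI).congr' ?_⟩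
  filter_upwards [eventually_ge_atTop t₀] with t ht
  simp [G, max_eq_right ht]

/-- A convergent nonnegative function `f` with `f t / t` dominated by an integrable function tends
to `0`, because `1 / t` is not integrable at infinity. -/
theorem tendsto_zero_of_div_le_integrable {t₀ L : ℝ} {f g : ℝ → ℝ} (ht₀ : 0 < t₀)
    (hf0 : ∀ t, t₀ ≤ t → 0 ≤ f t) (hfL : Tendsto f atTop (𝓝 L))
    (hfg : ∀ t, t₀ ≤ t → f t ≤ t * g t) (hg : IntegrableOn g (Ici t₀)) :
    Tendsto f atTop (𝓝 0) := by
  have hL : 0 ≤ L := ge_of_tendsto hfL (by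
    filter_upwards [eventually_ge_atTop t₀] with t ht using hf0 t ht)
  rcases hL.eq_or_lt with rfl | hL
  · exact hfL
  obtain ⟨T, hT⟩ := eventually_atTop.1 (hfL.eventually (lt_mem_nhds (half_lt_self hL)))
  refine absurd ?_ (not_integrableOn_Ioi_inv (a := max T t₀))
  have hsub : Ioi (max T t₀) ⊆ Ici t₀ := fun t ht => (le_max_right T t₀).trans (le_of_lt ht)
  refine ((hg.mono_set hsub).const_mul (2 / L)).mono' (by fun_prop) ?_
  refine (ae_restrict_iff' measurableSet_Ioi).2 (Eventually.of_forall fun t ht => ?_)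
  have ht0 : t₀ ≤ t := hsub ht
  have htT : T ≤ t := (le_max_left T t₀).trans (le_of_lt ht)
  have htpos : 0 < t := ht₀.trans_le ht0
  have h1 : L / 2 < t * g t := (hT t htT).trans_le (hfg t ht0)
  rw [Real.norm_of_nonneg (by positivity), inv_le_iff_one_le_mul₀ htpos, div_mul_eq_mul_div,
    div_mul_eq_mul_div, one_le_div hL]
  linarith

/-! ### Weak convergence in Hilbert space -/

section Weak

variable {H : Type*} [NormedAddCommGroup H] [InnerProductSpace ℝ H]

/-- Bounded trajectories have a weak limit along every ultrafilter (Banach–Alaoglu and the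
Fréchet–Riesz representation). -/
theorem Ultrafilter.exists_tendsto_inner [CompleteSpace H] {ι : Type*} (U : Ultrafilter ι)
    {x : ι → H} {R : ℝ} (hx : ∀ᶠ i in (U : Filter ι), ‖x i‖ ≤ R) :
    ∃ z : H, ∀ h : H, Tendsto (fun i => ⟪x i, h⟫) U (𝓝 ⟪z, h⟫) := by
  let φ : ι → WeakDual ℝ H := fun i =>
    StrongDual.toWeakDual (InnerProductSpace.toDual ℝ H (x i))
  have hK := WeakDual.isCompact_closedBall (𝕜 := ℝ) (E := H) 0 R
  have hmem : ∀ᶠ i in (U : Filter ι),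
      φ i ∈ WeakDual.toStrongDual ⁻¹' Metric.closedBall (0 : StrongDual ℝ H) R := by
    filter_upwards [hx] with i hi
    simpa [φ] using hi
  obtain ⟨ψ, -, hψ⟩ := isCompact_iff_ultrafilter_le_nhds.1 hK (U.map φ) (le_principal_iff.2 hmem)
  refine ⟨(InnerProductSpace.toDual ℝ H).symm (WeakDual.toStrongDual ψ), fun h => ?_⟩
  rw [InnerProductSpace.toDual_symm_apply]
  have := ((WeakDual.eval_continuous h).tendsto ψ).comp (show Tendsto φ U (𝓝 ψ) from hψ)
  simpa [φ, Function.comp_def] using this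

theorem tendsto_toWeakSpace_of_inner [CompleteSpace H] {ι : Type*} {l : Filter ι} {x : ι → H}
    {z : H} (h : ∀ y : H, Tendsto (fun i => ⟪x i, y⟫) l (𝓝 ⟪z, y⟫)) :
    Tendsto (fun i => toWeakSpace ℝ H (x i)) l (𝓝 (toWeakSpace ℝ H z)) := by
  have hinj : Function.Injective (topDualPairing ℝ H).flip := by
    intro a b hab
    refine ext_inner_left ℝ fun y => ?_
    exact DFunLike.congr_fun hab (InnerProductSpace.toDual ℝ H y)
  refine (WeakBilin.tendsto_iff_forall_eval_tendsto (topDualPairing ℝ H).flip hinj).2 fun f => ?_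
  have := h ((InnerProductSpace.toDual ℝ H).symm f)
  have heval : ∀ u : H, ⟪u, (InnerProductSpace.toDual ℝ H).symm f⟫ = f u := fun u => by
    rw [real_inner_comm, InnerProductSpace.toDual_symm_apply]
  simp only [heval] at this
  exact this

/-- Opial's lemma: if the distance to every point of `S` converges and every weak limit along an
ultrafilter lies in `S`, then the trajectory converges weakly to a point of `S`. -/
theorem exists_weak_limit_of_opial [CompleteSpace H] {ι : Type*} {l : Filter ι} [l.NeBot]
    {x : ι → H} {S : Set H} (hS : S.Nonempty)
    (hdist : ∀ z ∈ S, ∃ L : ℝ, Tendsto (fun i => ‖x i - z‖ ^ 2) l (𝓝 L))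
    (hclus : ∀ (U : Ultrafilter ι), (U : Filter ι) ≤ l → ∀ z : H,
      (∀ h : H, Tendsto (fun i => ⟪x i, h⟫) U (𝓝 ⟪z, h⟫)) → z ∈ S) :
    ∃ z ∈ S, Tendsto (fun i => toWeakSpace ℝ H (x i)) l (𝓝 (toWeakSpace ℝ H z)) := by
  obtain ⟨z₀, hz₀⟩ := hS
  obtain ⟨L₀, hL₀⟩ := hdist z₀ hz₀
  have hbdd : ∀ᶠ i in l, ‖x i‖ ≤ ‖z₀‖ + (L₀ + 2) := by
    filter_upwards [hL₀.eventually (gt_mem_nhds (lt_add_one L₀))] with i hi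
    have h1 : ‖x i‖ ≤ ‖x i - z₀‖ + ‖z₀‖ := norm_le_norm_sub_add _ _
    nlinarith [sq_nonneg (‖x i - z₀‖ - 1), norm_nonneg (x i - z₀)]
  have hlim : ∀ U : Ultrafilter ι, (U : Filter ι) ≤ l → ∃ z ∈ S, ∀ h : H,
      Tendsto (fun i => ⟪x i, h⟫) U (𝓝 ⟪z, h⟫) := by
    intro U hU
    obtain ⟨z, hz⟩ := U.exists_tendsto_inner (hU hbdd)
    exact ⟨z, hclus U hU z hz, hz⟩
  obtain ⟨z, hzS, hz⟩ := hlim (Ultrafilter.of l) (Ultrafilter.of_le l)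
  refine ⟨z, hzS, tendsto_toWeakSpace_of_inner fun h => ?_⟩
  refine (tendsto_iff_ultrafilter _ _ _).2 fun U hU => ?_
  obtain ⟨w, hwS, hw⟩ := hlim U hU
  suffices w = z by rw [← this]; exact hw h
  obtain ⟨L₁, hL₁⟩ := hdist z hzS
  obtain ⟨L₂, hL₂⟩ := hdist w hwS
  -- The difference of the two squared distances is affine in the trajectory.
  have hconv : Tendsto (fun i => ⟪x i, w - z⟫) l
      (𝓝 ((L₁ - L₂ - ‖z‖ ^ 2 + ‖w‖ ^ 2) / 2)) := by
    refine (((hL₁.sub hL₂).sub_const (‖z‖ ^ 2)).add_const (‖w‖ ^ 2)).div_const 2 |>.congr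
      fun i => ?_
    rw [norm_sub_sq_real, norm_sub_sq_real, inner_sub_right]
    ring
  have h1 := tendsto_nhds_unique (hw (w - z)) (hconv.mono_left hU)
  have h2 := tendsto_nhds_unique (hz (w - z)) (hconv.mono_left (Ultrafilter.of_le l))
  have h3 : ⟪w - z, w - z⟫ = 0 := by rw [inner_sub_left, h1, h2, sub_self]
  exact sub_eq_zero.1 (inner_self_eq_zero.1 h3)

/-- Minty's argument: for a continuous operator the variational inequality with the operator
evaluated at the test point forces a zero. -/
theorem eq_zero_of_minty {Q : H → H} (hQ : Continuous Q) {z : H}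
    (h : ∀ u : H, 0 ≤ ⟪Q u, u - z⟫) : Q z = 0 := by
  -- Test with `u = z - s Q(z)` and let `s ↓ 0`.
  have hlim : Tendsto (fun s : ℝ => ⟪Q (z - s • Q z), Q z⟫) (𝓝[>] 0) (𝓝 ⟪Q z, Q z⟫) := by
    have hc : Continuous fun s : ℝ => ⟪Q (z - s • Q z), Q z⟫ := by fun_prop
    simpa using (hc.tendsto 0).mono_left nhdsWithin_le_nhds
  have hle : ⟪Q z, Q z⟫ ≤ 0 := by
    refine le_of_tendsto hlim ?_
    filter_upwards [self_mem_nhdsWithin] with s hs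
    have h1 := h (z - s • Q z)
    rw [sub_sub_cancel_left, inner_neg_right, inner_smul_right] at h1
    have hs' : 0 < s := hs
    by_contra! h2
    nlinarith [mul_pos hs' h2]
  exact real_inner_self_nonpos.1 hle

/-- The graph of a continuous monotone operator is closed for weak convergence of the argument and
strong convergence of the value; the case of value `0`. -/
theorem IsMonotoneOperator.eq_zero_of_weak_limit {Q : H → H} (hmono : IsMonotoneOperator Q)
    (hQ : Continuous Q) {ι : Type*} {l : Filter ι} [l.NeBot] {x : ι → H} {z : H} {R : ℝ}
    (hbdd : ∀ᶠ i in l, ‖x i‖ ≤ R) (hQx : Tendsto (fun i => Q (x i)) l (𝓝 0))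
    (hx : ∀ h : H, Tendsto (fun i => ⟪x i, h⟫) l (𝓝 ⟪z, h⟫)) : Q z = 0 := by
  refine eq_zero_of_minty hQ fun u => ?_
  have h1 : Tendsto (fun i => ⟪Q u, u - x i⟫) l (𝓝 ⟪Q u, u - z⟫) := by
    simp only [inner_sub_right, real_inner_comm (x _) (Q u), real_inner_comm z (Q u)]
    simpa only [real_inner_comm] using (hx (Q u)).const_sub ⟪Q u, u⟫
  have h2 : Tendsto (fun i => ⟪Q (x i), u - x i⟫) l (𝓝 0) := by
    have hb : Tendsto (fun i => ‖Q (x i)‖ * (‖u‖ + R)) l (𝓝 0) := by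
      simpa using (tendsto_zero_iff_norm_tendsto_zero.1 hQx).mul_const (‖u‖ + R)
    refine squeeze_zero_norm' ?_ hb
    filter_upwards [hbdd] with i hi
    refine (norm_inner_le_norm _ _).trans ?_
    gcongr
    exact (norm_sub_le _ _).trans (by gcongr)
  refine ge_of_tendsto (by simpa using h1.sub h2) (Eventually.of_forall fun i => ?_)
  rw [← inner_sub_left]
  exact hmono u (x i)

end Weak

/-! ### The Lyapunov functions -/

section Energy

variable {H : Type*} [NormedAddCommGroup H] [InnerProductSpace ℝ H]

/-- The part of the Lyapunov function that does not involve the position, at the time `t` and for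
the values `β = β(t)`, `v = x'(t)`, `q = Q (x(t))`. -/
noncomputable def kineticEnergy (η t β : ℝ) (v q : H) : ℝ :=
  1 / 2 * ‖t • v + ((1 - η) * (t * β)) • q‖ ^ 2 + 1 / 2 * (η * (1 - η)) * ‖(t * β) • q‖ ^ 2

/-- The coupling of position and velocity: the coefficient of the parameter `lam` in the Lyapunov
function `kineticEnergy + lam * coupling`. Here `y = x - x*`. -/
noncomputable def coupling (α t β : ℝ) (y v q : H) : ℝ :=
  ⟪y, t • v + (t * β) • q⟫ + 1 / 2 * (α - 1) * ‖y‖ ^ 2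

/-- The Lyapunov function with parameter `lam` is affine in `lam` by definition; this form shows
that it is nonnegative for `0 ≤ lam ≤ α - 1`. -/
theorem kineticEnergy_add_coupling (α η t β lam : ℝ) (y v q : H) :
    kineticEnergy η t β v q + lam * coupling α t β y v q =
      1 / 2 * ‖lam • y + (t • v + ((1 - η) * (t * β)) • q)‖ ^ 2
        + 1 / 2 * (lam * (α - 1 - lam)) * ‖y‖ ^ 2 + η * lam * (t * β * ⟪q, y⟫)
        + 1 / 2 * (η * (1 - η)) * ‖(t * β) • q‖ ^ 2 := by
  rw [kineticEnergy, coupling, norm_add_sq_real (lam • y), norm_smul lam, mul_pow,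
    Real.norm_eq_abs, sq_abs]
  simp only [inner_add_right, inner_smul_left, inner_smul_right, real_inner_comm y q,
    RCLike.conj_to_real]
  ring

theorem kineticEnergy_nonneg {η : ℝ} (hη : η ∈ Ioo (0 : ℝ) 1) (t β : ℝ) (v q : H) :
    0 ≤ kineticEnergy η t β v q := by
  have := mul_pos hη.1 (sub_pos.2 hη.2)
  unfold kineticEnergy
  positivity

theorem kineticEnergy_le {η : ℝ} (hη : η ∈ Ioo (0 : ℝ) 1) (t β : ℝ) (v q : H) :
    kineticEnergy η t β v q ≤ t * (2 * (t * ‖v‖ ^ 2 + t * β ^ 2 * ‖q‖ ^ 2)) := by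
  have h1 : ‖t • v + ((1 - η) * (t * β)) • q‖ ^ 2 ≤
      2 * (‖t • v‖ ^ 2 + ‖((1 - η) * (t * β)) • q‖ ^ 2) := by
    have := parallelogram_law_with_norm ℝ (t • v) (((1 - η) * (t * β)) • q)
    nlinarith [sq_nonneg ‖t • v - ((1 - η) * (t * β)) • q‖]
  simp only [norm_smul, mul_pow, Real.norm_eq_abs, sq_abs] at h1
  simp only [kineticEnergy, norm_smul, mul_pow, Real.norm_eq_abs, sq_abs]
  have h2 : (1 - η) ^ 2 + 1 / 2 * (η * (1 - η)) ≤ 2 := by nlinarith [hη.1, hη.2]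
  have h3 : 0 ≤ t ^ 2 * β ^ 2 * ‖q‖ ^ 2 := by positivity
  have h4 : 0 ≤ t ^ 2 * ‖v‖ ^ 2 := by positivity
  nlinarith [mul_le_mul_of_nonneg_right h2 h3]

/-- Monotonicity in infinitesimal form. -/
theorem IsMonotoneOperator.inner_deriv_nonneg {Q : H → H} (hQ : IsMonotoneOperator Q)
    {x : ℝ → H} {t : ℝ} {v q' : H} (hx : HasDerivAt x v t)
    (hq : HasDerivAt (fun s => Q (x s)) q' t) : 0 ≤ ⟪v, q'⟫ := by
  refine ge_of_tendsto ((hasDerivAt_iff_tendsto_slope.1 hx).inner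
    (hasDerivAt_iff_tendsto_slope.1 hq)) (Eventually.of_forall fun s => ?_)
  rw [slope_def_module, slope_def_module, inner_smul_left, inner_smul_right, real_inner_comm,
    RCLike.conj_to_real, ← mul_assoc]
  exact mul_nonneg (mul_self_nonneg _) (hQ _ _)

/-- The derivative of the Lyapunov function along a solution. The hypothesis `hode` is the
differential equation multiplied by `t`; it is used to eliminate the second derivative `v'`. -/
theorem hasDerivAt_lyapunov (α η lam : ℝ) {t β' : ℝ} {v' q' : H} {β : ℝ → ℝ} {y v q : ℝ → H}
    (hβ : HasDerivAt β β' t) (hy : HasDerivAt y (v t) t) (hv : HasDerivAt v v' t)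
    (hq : HasDerivAt q q' t)
    (hode : t • v' = -(α • v t + (t * β t) • q'
      + ((1 - η) * (t * β') + theta α η * β t) • q t)) :
    HasDerivAt (fun s => kineticEnergy η s (β s) (v s) (q s)
        + lam * coupling α s (β s) (y s) (v s) (q s))
      (-(α - 1 - lam) * (t * ‖v t‖ ^ 2 + t * β t * ⟪v t, q t⟫)
        - ((α - 2) * β t - t * β') * (η * (1 - η) * (t * β t) * ‖q t‖ ^ 2 + η * lam * ⟪q t, y t⟫)
        - η * (t ^ 2 * β t) * ⟪v t, q'⟫) t := by
  have htβ : HasDerivAt (fun s => s * β s) (1 * β t + t * β') t := (hasDerivAt_id t).mul hβ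
  have htv : HasDerivAt (fun s => s • v s) (t • v' + (1 : ℝ) • v t) t :=
    (hasDerivAt_id t).smul hv
  have htq := htβ.smul hq
  have hP := htv.add ((htβ.const_mul (1 - η)).smul hq)
  have hA := (hP.norm_sq.const_mul (1 / 2)).add (htq.norm_sq.const_mul (1 / 2 * (η * (1 - η))))
  have hp := (hy.inner ℝ (htv.add htq)).add (hy.norm_sq.const_mul (1 / 2 * (α - 1)))
  refine (hA.add (hp.const_mul lam)).congr_deriv ?_
  rw [hode]
  simp only [Pi.add_apply, Pi.smul_apply', inner_add_left, inner_add_right, inner_smul_left,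
    inner_smul_right, inner_neg_right, RCLike.conj_to_real, real_inner_self_eq_norm_sq, theta]
  rw [real_inner_comm (v t) (q t), real_inner_comm (y t) (q t)]
  ring

/-- The dissipation estimate, from the growth condition and monotonicity. -/
theorem lyapunov_deriv_le {α η ε lam t b b' r V N I M : ℝ} (hη : η ∈ Ioo (0 : ℝ) 1)
    (hlam : 0 ≤ lam) (ht : 0 ≤ t) (hb : 0 ≤ b) (hgrowth : t * b' ≤ (α - 2 - ε) * b)
    (hN : 0 ≤ N) (hI : 0 ≤ I) (hM : 0 ≤ M) :
    -(α - 1 - lam) * (t * V + t * b * r)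
        - ((α - 2) * b - t * b') * (η * (1 - η) * (t * b) * N + η * lam * I)
        - η * (t ^ 2 * b) * M ≤
      -(α - 1 - lam) * (t * V + t * b * r)
        - ε * (η * (1 - η) * (t * b ^ 2 * N) + η * lam * (b * I)) := by
  have h1 := hη.1
  have h2 := sub_pos.2 hη.2
  have h3 : 0 ≤ η * (1 - η) * (t * b) * N + η * lam * I := by positivity
  have h4 : 0 ≤ η * (t ^ 2 * b) * M := by positivity
  have h5 : ε * b ≤ (α - 2) * b - t * b' := by linarith
  have h6 := mul_le_mul_of_nonneg_right h5 h3
  nlinarith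

end Energy

/-! ### Energy estimates along solutions -/

section Flow

variable {H : Type*} [NormedAddCommGroup H] [InnerProductSpace ℝ H]

theorem hasDerivAt_dot {E : Type*} [NormedAddCommGroup E] [NormedSpace ℝ E] {t₀ t : ℝ} {f : ℝ → E}
    (hf : DifferentiableOn ℝ f (Ici t₀)) (ht : t₀ < t) : HasDerivAt f (dot t₀ f t) t :=
  (hf t ht.le).hasDerivWithinAt.hasDerivAt (Ici_mem_nhds ht)

/-- The standing assumptions on the operator, the parameters and the trajectory. -/
structure DampedMonotoneFlow (Q : H → H) (t₀ α η ε : ℝ) (β : ℝ → ℝ) (x : ℝ → H) : Prop where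
  mono : IsMonotoneOperator Q
  lipschitz : ∃ K : ℝ≥0, LipschitzWith K Q
  t₀_pos : 0 < t₀
  two_le_α : 2 ≤ α
  η_mem : η ∈ Ioo (0 : ℝ) 1
  ε_nonneg : 0 ≤ ε
  β_pos : ∀ t : ℝ, t₀ ≤ t → 0 < β t
  β_diff : DifferentiableOn ℝ β (Ici t₀)
  growth : GrowthCondition t₀ α ε β
  solution : IsStrongSolution Q t₀ α η β x

/-- The Lyapunov function with parameter `lam` along the trajectory `x`, relative to `z`. -/
noncomputable def lyapunov (Q : H → H) (t₀ α η : ℝ) (β : ℝ → ℝ) (x : ℝ → H) (z : H)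
    (lam t : ℝ) : ℝ :=
  kineticEnergy η t (β t) (dot t₀ x t) (Q (x t))
    + lam * coupling α t (β t) (x t - z) (dot t₀ x t) (Q (x t))

namespace DampedMonotoneFlow

variable {Q : H → H} {t₀ α η ε : ℝ} {β : ℝ → ℝ} {x : ℝ → H}

theorem growth' (h : DampedMonotoneFlow Q t₀ α η ε β x) {t : ℝ} (ht : t₀ ≤ t) :
    0 ≤ dot t₀ β t ∧ t * dot t₀ β t ≤ (α - 2 - ε) * β t := by
  have hβ := h.β_pos t ht
  obtain ⟨h1, h2⟩ := h.growth t ht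
  rw [div_le_iff₀ hβ] at h2
  refine ⟨?_, by linarith⟩
  have h3 : 0 ≤ dot t₀ β t * t := by
    have := mul_nonneg h1 hβ.le
    rwa [div_mul_cancel₀ _ hβ.ne'] at this
  exact nonneg_of_mul_nonneg_left h3 (h.t₀_pos.trans_le ht)

/-- The growth condition bounds `β'` on compact intervals although `β'` need not be continuous. -/
theorem locallyAC_β (h : DampedMonotoneFlow Q t₀ α η ε β x) : LocallyAC t₀ β := by
  refine LocallyAC.of_bounded_dot h.β_diff fun T hT => ?_
  obtain ⟨M, hM⟩ := isCompact_Icc.exists_bound_of_continuousOn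
    (h.β_diff.continuousOn.mono (Icc_subset_Ici_self : Icc t₀ T ⊆ Ici t₀))
  refine ⟨(α - 2) * M / t₀, fun t ht => ?_⟩
  obtain ⟨h1, h2⟩ := h.growth' ht.1
  have hβ := h.β_pos t ht.1
  have hM' : β t ≤ M := (le_abs_self _).trans (hM t ht)
  rw [abs_of_nonneg h1, le_div_iff₀ h.t₀_pos]
  nlinarith [mul_le_mul_of_nonneg_right ht.1 h1, mul_nonneg h.ε_nonneg hβ.le,
    mul_le_mul_of_nonneg_left hM' (sub_nonneg.2 h.two_le_α)]

/-- The growth condition makes `β` nondecreasing. -/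
theorem β_ge (h : DampedMonotoneFlow Q t₀ α η ε β x) {t : ℝ} (ht : t₀ ≤ t) : β t₀ ≤ β t := by
  refine monotoneOn_of_deriv_nonneg (convex_Ici t₀) h.β_diff.continuousOn
    (h.β_diff.mono interior_subset) (fun s hs => ?_) self_mem_Ici ht ht
  rw [interior_Ici] at hs
  rw [(hasDerivAt_dot h.β_diff hs).deriv]
  exact (h.growth' hs.le).1

theorem locallyAC_Q (h : DampedMonotoneFlow Q t₀ α η ε β x) :
    LocallyAC t₀ (fun t => Q (x t)) :=
  h.lipschitz.elim fun _ hK => h.solution.locallyAC.lipschitz_comp hK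

theorem inner_nonneg (h : DampedMonotoneFlow Q t₀ α η ε β x) {z : H} (hz : Q z = 0) (t : ℝ) :
    0 ≤ ⟪Q (x t), x t - z⟫ := by
  simpa [hz] using h.mono (x t) z

theorem locallyAC_lyapunov (h : DampedMonotoneFlow Q t₀ α η ε β x) (z : H) (lam : ℝ) :
    LocallyAC t₀ (lyapunov Q t₀ α η β x z lam) := by
  have hv := h.solution.locallyAC_dot
  have htβ : LocallyAC t₀ (fun t => t * β t) := LocallyAC.id.mul h.locallyAC_β
  have htv : LocallyAC t₀ (fun t => t • dot t₀ x t) := LocallyAC.id.smul hv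
  have hy := h.solution.locallyAC.sub (LocallyAC.const z)
  have hA := ((LocallyAC.const (1 / 2)).mul
      (htv.add (((LocallyAC.const (1 - η)).mul htβ).smul h.locallyAC_Q)).norm_sq).add
    ((LocallyAC.const (1 / 2 * (η * (1 - η)))).mul (htβ.smul h.locallyAC_Q).norm_sq)
  have hp := (hy.inner (htv.add (htβ.smul h.locallyAC_Q))).add
    ((LocallyAC.const (1 / 2 * (α - 1))).mul hy.norm_sq)
  exact hA.add ((LocallyAC.const lam).mul hp)

/-- The integrated dissipation estimate. -/
theorem lyapunov_sub_le (h : DampedMonotoneFlow Q t₀ α η ε β x) {z : H} (hz : Q z = 0)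
    {lam : ℝ} (hlam : 0 ≤ lam) {g : ℝ → ℝ} (hg : ContinuousOn g (Ici t₀))
    (hDg : ∀ t, t₀ ≤ t →
      -(α - 1 - lam) * (t * ‖dot t₀ x t‖ ^ 2 + t * β t * ⟪dot t₀ x t, Q (x t)⟫)
        - ε * (η * (1 - η) * (t * β t ^ 2 * ‖Q (x t)‖ ^ 2)
          + η * lam * (β t * ⟪Q (x t), x t - z⟫)) ≤ g t)
    {s t : ℝ} (hs : t₀ ≤ s) (hst : s ≤ t) :
    lyapunov Q t₀ α η β x z lam t - lyapunov Q t₀ α η β x z lam s ≤ ∫ τ in s..t, g τ := by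
  refine (h.locallyAC_lyapunov z lam).sub_le_integral hg ?_ hs hst
  filter_upwards [h.solution.equation, ae_restrict_mem measurableSet_Ici,
    ae_restrict_of_ae (Measure.ae_ne volume t₀)] with t hode ht hne
  -- At `t₀` the symbol `dot` is only a one-sided derivative, so this point is discarded.
  obtain ⟨hv, hq, hode⟩ := hode
  have ht' : t₀ < t := lt_of_le_of_ne ht (Ne.symm hne)
  have htpos : 0 < t := h.t₀_pos.trans ht'
  have hx := hasDerivAt_dot h.solution.differentiableOn ht'
  have hode' : t • deriv (dot t₀ x) t = -(α • dot t₀ x t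
      + (t * β t) • deriv (fun s => Q (x s)) t
      + ((1 - η) * (t * dot t₀ β t) + theta α η * β t) • Q (x t)) := by
    have h1 := congrArg (fun u => t • u) hode
    simp only [smul_add, smul_zero, smul_smul] at h1
    have h2 : t * (α / t) = α := by field_simp
    have h3 : t * bCoeff t₀ α η β t = (1 - η) * (t * dot t₀ β t) + theta α η * β t := by
      rw [bCoeff]; field_simp
    rw [h2, h3] at h1
    rw [eq_neg_iff_add_eq_zero, ← h1]
    abel
  have hder := hasDerivAt_lyapunov α η lam (hasDerivAt_dot h.β_diff ht') (hx.sub_const z)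
    hv.hasDerivAt hq.hasDerivAt hode'
  rw [show deriv (lyapunov Q t₀ α η β x z lam) t = _ from hder.deriv]
  exact (lyapunov_deriv_le h.η_mem hlam htpos.le (h.β_pos t ht).le (h.growth' ht).2
    (sq_nonneg _) (h.inner_nonneg hz t) (h.mono.inner_deriv_nonneg hx hq.hasDerivAt)).trans
    (hDg t ht)

/-- For `lam = α - 1` the Lyapunov function controls both quantities whose decay is claimed. -/
theorem le_lyapunov (z : H) (t : ℝ) :
    η * (α - 1) * (t * β t * ⟪Q (x t), x t - z⟫)
      + 1 / 2 * (η * (1 - η)) * ‖(t * β t) • Q (x t)‖ ^ 2 ≤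
      lyapunov Q t₀ α η β x z (α - 1) t := by
  rw [lyapunov, kineticEnergy_add_coupling, sub_self, mul_zero, mul_zero, zero_mul, add_zero]
  have : 0 ≤ 1 / 2 * ‖(α - 1) • (x t - z)
    + (t • dot t₀ x t + ((1 - η) * (t * β t)) • Q (x t))‖ ^ 2 := by positivity
  linarith

theorem lyapunov_nonneg (h : DampedMonotoneFlow Q t₀ α η ε β x) {z : H} (hz : Q z = 0) {t : ℝ}
    (ht : t₀ ≤ t) : 0 ≤ lyapunov Q t₀ α η β x z (α - 1) t := by
  refine le_trans ?_ (le_lyapunov z t)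
  have h1 := h.η_mem.1
  have h2 := sub_pos.2 h.η_mem.2
  have h3 : 0 ≤ α - 1 := by linarith [h.two_le_α]
  have h4 := h.t₀_pos.trans_le ht
  have h5 := h.β_pos t ht
  have h6 := h.inner_nonneg hz t
  positivity

theorem continuousOn_inner (h : DampedMonotoneFlow Q t₀ α η ε β x) (z : H) :
    ContinuousOn (fun t => β t * ⟪Q (x t), x t - z⟫) (Ici t₀) :=
  (h.locallyAC_β.mul
    (h.locallyAC_Q.inner (h.solution.locallyAC.sub (LocallyAC.const z)))).continuousOn

theorem continuousOn_norm_Q (h : DampedMonotoneFlow Q t₀ α η ε β x) :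
    ContinuousOn (fun t => t * β t ^ 2 * ‖Q (x t)‖ ^ 2) (Ici t₀) :=
  ((LocallyAC.id.mul h.locallyAC_β.norm_sq).mul h.locallyAC_Q.norm_sq).continuousOn.congr
    fun t _ => by simp

theorem continuousOn_norm_dot (h : DampedMonotoneFlow Q t₀ α η ε β x) :
    ContinuousOn (fun t => t * ‖dot t₀ x t‖ ^ 2) (Ici t₀) :=
  (LocallyAC.id.mul h.solution.locallyAC_dot.norm_sq).continuousOn

/-- For `lam = α - 1` the quadratic form in the velocity disappears from the dissipation. -/
theorem lyapunov_sub_le_dissipation (h : DampedMonotoneFlow Q t₀ α η ε β x) {z : H} (hz : Q z = 0)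
    {s t : ℝ} (hs : t₀ ≤ s) (hst : s ≤ t) :
    lyapunov Q t₀ α η β x z (α - 1) t - lyapunov Q t₀ α η β x z (α - 1) s ≤
      ∫ τ in s..t, ((0 : ℝ) - ε * (η * (1 - η) * (τ * β τ ^ 2 * ‖Q (x τ)‖ ^ 2)
          + η * (α - 1) * (β τ * ⟪Q (x τ), x τ - z⟫))) := by
  refine h.lyapunov_sub_le hz (by linarith [h.two_le_α]) ?_ (fun τ _ => ?_) hs hst
  · exact continuousOn_const.sub (((h.continuousOn_norm_Q.const_mul _).add
      ((h.continuousOn_inner z).const_mul _)).const_mul _)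
  · rw [sub_self, neg_zero, zero_mul]

theorem dissipation_nonneg (h : DampedMonotoneFlow Q t₀ α η ε β x) {z : H} (hz : Q z = 0) {t : ℝ}
    (ht : t₀ ≤ t) : 0 ≤ η * (1 - η) * (t * β t ^ 2 * ‖Q (x t)‖ ^ 2) ∧
      0 ≤ η * (α - 1) * (β t * ⟪Q (x t), x t - z⟫) := by
  have h1 := h.η_mem.1
  have h2 := sub_pos.2 h.η_mem.2
  have h3 : 0 ≤ α - 1 := by linarith [h.two_le_α]
  have h4 := h.t₀_pos.trans_le ht
  have h5 := h.β_pos t ht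
  have h6 := h.inner_nonneg hz t
  constructor <;> positivity

/-- For `lam = α - 1` the Lyapunov function is nonincreasing, also when `ε = 0`. -/
theorem lyapunov_antitone (h : DampedMonotoneFlow Q t₀ α η ε β x) {z : H} (hz : Q z = 0)
    {s t : ℝ} (hs : t₀ ≤ s) (hst : s ≤ t) :
    lyapunov Q t₀ α η β x z (α - 1) t - lyapunov Q t₀ α η β x z (α - 1) s ≤
      ∫ _ in s..t, (0 : ℝ) := by
  refine h.lyapunov_sub_le hz (by linarith [h.two_le_α]) continuousOn_const (fun τ hτ => ?_) hs hst
  obtain ⟨h1, h2⟩ := h.dissipation_nonneg hz hτ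
  rw [sub_self, neg_zero, zero_mul, zero_sub, neg_nonpos]
  exact mul_nonneg h.ε_nonneg (add_nonneg h1 h2)

/-- For `lam = 0` the cross term is absorbed by the square of the operator value. -/
theorem kineticEnergy_sub_le (h : DampedMonotoneFlow Q t₀ α η ε β x) {z : H} (hz : Q z = 0)
    {s t : ℝ} (hs : t₀ ≤ s) (hst : s ≤ t) :
    lyapunov Q t₀ α η β x z 0 t - lyapunov Q t₀ α η β x z 0 s ≤
      ∫ τ in s..t, ((α - 1) / 2 * (τ * β τ ^ 2 * ‖Q (x τ)‖ ^ 2)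
        - (α - 1) / 2 * (τ * ‖dot t₀ x τ‖ ^ 2)) := by
  refine h.lyapunov_sub_le hz le_rfl ?_ (fun τ hτ => ?_) hs hst
  · exact (h.continuousOn_norm_Q.const_mul _).sub (h.continuousOn_norm_dot.const_mul _)
  · have h1 := mul_nonneg h.ε_nonneg (h.dissipation_nonneg hz hτ).1
    have h2 : 0 ≤ (α - 1) / 2 * (τ * ‖dot t₀ x τ + β τ • Q (x τ)‖ ^ 2) := by
      have := h.two_le_α
      have := h.t₀_pos.trans_le hτ
      have : 0 ≤ (α - 1) / 2 := by linarith
      positivity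
    rw [norm_add_sq_real, inner_smul_right, norm_smul, mul_pow, Real.norm_eq_abs, sq_abs] at h2
    linarith

/-! ### Rates, integrability and weak convergence -/

theorem lyapunov_le (h : DampedMonotoneFlow Q t₀ α η ε β x) {z : H} (hz : Q z = 0) {t : ℝ}
    (ht : t₀ ≤ t) : lyapunov Q t₀ α η β x z (α - 1) t ≤ lyapunov Q t₀ α η β x z (α - 1) t₀ := by
  have := h.lyapunov_antitone hz le_rfl ht
  rw [intervalIntegral.integral_zero] at this
  linarith

theorem isBigO_inner (h : DampedMonotoneFlow Q t₀ α η ε β x) {z : H} (hz : Q z = 0) :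
    (fun t => ⟪Q (x t), x t - z⟫) =O[atTop] (fun t => 1 / (t * β t)) := by
  have hc : 0 < η * (α - 1) := mul_pos h.η_mem.1 (by linarith [h.two_le_α])
  refine IsBigO.of_bound (lyapunov Q t₀ α η β x z (α - 1) t₀ / (η * (α - 1))) ?_
  filter_upwards [eventually_ge_atTop t₀] with t ht
  have htβ : 0 < t * β t := mul_pos (h.t₀_pos.trans_le ht) (h.β_pos t ht)
  have h0 : 0 ≤ 1 / 2 * (η * (1 - η)) * ‖(t * β t) • Q (x t)‖ ^ 2 := by
    have := mul_pos h.η_mem.1 (sub_pos.2 h.η_mem.2)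
    positivity
  have h1 := (le_lyapunov z t).trans (h.lyapunov_le hz ht)
  rw [Real.norm_of_nonneg (h.inner_nonneg hz t), Real.norm_of_nonneg (by positivity), mul_one_div,
    le_div_iff₀ htβ, le_div_iff₀ hc]
  linarith

theorem isBigO_norm (h : DampedMonotoneFlow Q t₀ α η ε β x) {z : H} (hz : Q z = 0) :
    (fun t => ‖Q (x t)‖) =O[atTop] (fun t => 1 / (t * β t)) := by
  have hc : 0 < 1 / 2 * (η * (1 - η)) := by
    have := mul_pos h.η_mem.1 (sub_pos.2 h.η_mem.2)
    positivity
  refine IsBigO.of_bound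
    (√(lyapunov Q t₀ α η β x z (α - 1) t₀ / (1 / 2 * (η * (1 - η))))) ?_
  filter_upwards [eventually_ge_atTop t₀] with t ht
  have htβ : 0 < t * β t := mul_pos (h.t₀_pos.trans_le ht) (h.β_pos t ht)
  have h0 : 0 ≤ η * (α - 1) * (t * β t * ⟪Q (x t), x t - z⟫) := by
    have := h.inner_nonneg hz t
    have := h.η_mem.1
    have : 0 ≤ α - 1 := by linarith [h.two_le_α]
    positivity
  have h1 := (le_lyapunov z t).trans (h.lyapunov_le hz ht)
  rw [norm_norm, Real.norm_of_nonneg (by positivity), mul_one_div, le_div_iff₀ htβ]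
  refine Real.le_sqrt_of_sq_le ?_
  rw [norm_smul, Real.norm_of_nonneg htβ.le] at h1
  rw [le_div_iff₀ hc]
  linarith

theorem integrableOn_dissipation (h : DampedMonotoneFlow Q t₀ α η ε β x) {z : H} (hz : Q z = 0)
    (hε : 0 < ε) : IntegrableOn (fun t => η * (1 - η) * (t * β t ^ 2 * ‖Q (x t)‖ ^ 2)
      + η * (α - 1) * (β t * ⟪Q (x t), x t - z⟫)) (Ici t₀) := by
  have hcont : ContinuousOn (fun t => η * (1 - η) * (t * β t ^ 2 * ‖Q (x t)‖ ^ 2)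
      + η * (α - 1) * (β t * ⟪Q (x t), x t - z⟫)) (Ici t₀) :=
    (h.continuousOn_norm_Q.const_mul _).add ((h.continuousOn_inner z).const_mul _)
  have := integrableOn_Ici_of_dissipation (h := fun _ => 0)
    (fun t ht => h.lyapunov_nonneg hz ht) (hcont.const_mul ε)
    (fun t ht => mul_nonneg hε.le (add_nonneg (h.dissipation_nonneg hz ht).1
      (h.dissipation_nonneg hz ht).2))
    continuousOn_const integrableOn_zero (fun _ _ => le_rfl)
    (fun t ht => h.lyapunov_sub_le_dissipation hz le_rfl ht)
  refine (this.const_mul ε⁻¹).congr (Eventually.of_forall fun t => ?_)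
  exact inv_mul_cancel_left₀ hε.ne' _

theorem integrableOn_norm_Q (h : DampedMonotoneFlow Q t₀ α η ε β x) {z : H} (hz : Q z = 0)
    (hε : 0 < ε) : IntegrableOn (fun t => t * β t ^ 2 * ‖Q (x t)‖ ^ 2) (Ici t₀) := by
  have hc := mul_pos h.η_mem.1 (sub_pos.2 h.η_mem.2)
  refine ((h.integrableOn_dissipation hz hε).const_mul (η * (1 - η))⁻¹).mono'
    (h.continuousOn_norm_Q.aestronglyMeasurable measurableSet_Ici)
    ((ae_restrict_iff' measurableSet_Ici).2 (Eventually.of_forall fun t ht => ?_))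
  have htpos := h.t₀_pos.trans_le ht
  rw [Real.norm_of_nonneg (by positivity), le_inv_mul_iff₀ hc]
  linarith [(h.dissipation_nonneg hz ht).2]

theorem integrableOn_inner (h : DampedMonotoneFlow Q t₀ α η ε β x) {z : H} (hz : Q z = 0)
    (hε : 0 < ε) : IntegrableOn (fun t => β t * ⟪Q (x t), x t - z⟫) (Ici t₀) := by
  have hc : 0 < η * (α - 1) := mul_pos h.η_mem.1 (by linarith [h.two_le_α])
  refine ((h.integrableOn_dissipation hz hε).const_mul (η * (α - 1))⁻¹).mono'
    ((h.continuousOn_inner z).aestronglyMeasurable measurableSet_Ici)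
    ((ae_restrict_iff' measurableSet_Ici).2 (Eventually.of_forall fun t ht => ?_))
  rw [Real.norm_of_nonneg (mul_nonneg (h.β_pos t ht).le (h.inner_nonneg hz t)),
    le_inv_mul_iff₀ hc]
  linarith [(h.dissipation_nonneg hz ht).1]

theorem lyapunov_zero_nonneg (h : DampedMonotoneFlow Q t₀ α η ε β x) (z : H) (t : ℝ) :
    0 ≤ lyapunov Q t₀ α η β x z 0 t := by
  rw [lyapunov, zero_mul, add_zero]
  exact kineticEnergy_nonneg h.η_mem _ _ _ _

theorem integrableOn_norm_dot (h : DampedMonotoneFlow Q t₀ α η ε β x) {z : H} (hz : Q z = 0)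
    (hε : 0 < ε) : IntegrableOn (fun t => t * ‖dot t₀ x t‖ ^ 2) (Ici t₀) := by
  have hc : 0 < (α - 1) / 2 := by linarith [h.two_le_α]
  have := integrableOn_Ici_of_dissipation (fun t _ => h.lyapunov_zero_nonneg z t)
    (h.continuousOn_norm_dot.const_mul ((α - 1) / 2))
    (fun t ht => by have := h.t₀_pos.trans_le ht; positivity)
    (h.continuousOn_norm_Q.const_mul ((α - 1) / 2))
    ((h.integrableOn_norm_Q hz hε).const_mul ((α - 1) / 2))
    (fun t ht => by have := h.t₀_pos.trans_le ht; positivity)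
    (fun t ht => h.kineticEnergy_sub_le hz le_rfl ht)
  refine (this.const_mul ((α - 1) / 2)⁻¹).congr (Eventually.of_forall fun t => ?_)
  exact inv_mul_cancel_left₀ hc.ne' _

/-- The kinetic energy converges, and its quotient by `t` is integrable, so its limit is `0`. -/
theorem tendsto_kineticEnergy (h : DampedMonotoneFlow Q t₀ α η ε β x) {z : H} (hz : Q z = 0)
    (hε : 0 < ε) :
    Tendsto (fun t => kineticEnergy η t (β t) (dot t₀ x t) (Q (x t))) atTop (𝓝 0) := by
  have heq : (fun t => kineticEnergy η t (β t) (dot t₀ x t) (Q (x t)))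
      = lyapunov Q t₀ α η β x z 0 := by
    funext t
    rw [lyapunov, zero_mul, add_zero]
  have hc : 0 ≤ (α - 1) / 2 := by linarith [h.two_le_α]
  have hQ := h.integrableOn_norm_Q hz hε
  obtain ⟨L, hL⟩ := exists_tendsto_of_sub_le_integral
    (fun t _ => h.lyapunov_zero_nonneg z t)
    ((h.continuousOn_norm_Q.const_mul ((α - 1) / 2)).sub
      (h.continuousOn_norm_dot.const_mul ((α - 1) / 2)))
    ((hQ.const_mul ((α - 1) / 2)).sub ((h.integrableOn_norm_dot hz hε).const_mul ((α - 1) / 2)))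
    (fun s t hs hst => h.kineticEnergy_sub_le hz hs hst)
  refine tendsto_zero_of_div_le_integrable h.t₀_pos
    (fun t _ => kineticEnergy_nonneg h.η_mem _ _ _ _) (heq ▸ hL)
    (fun t _ => kineticEnergy_le h.η_mem _ _ _ _)
    (((h.integrableOn_norm_dot hz hε).add hQ).const_mul 2)

theorem tendsto_smul_Q (h : DampedMonotoneFlow Q t₀ α η ε β x) {z : H} (hz : Q z = 0)
    (hε : 0 < ε) : Tendsto (fun t => (t * β t) • Q (x t)) atTop (𝓝 0) := by
  have hc := mul_pos h.η_mem.1 (sub_pos.2 h.η_mem.2)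
  have hsq : Tendsto (fun t => ‖(t * β t) • Q (x t)‖ ^ 2) atTop (𝓝 0) := by
    refine squeeze_zero (fun _ => sq_nonneg _) (fun t => ?_)
      (by simpa only [mul_zero] using
        ((h.tendsto_kineticEnergy hz hε).const_mul 2).const_mul (η * (1 - η))⁻¹)
    rw [le_inv_mul_iff₀ hc, kineticEnergy]
    linarith [sq_nonneg ‖t • dot t₀ x t + ((1 - η) * (t * β t)) • Q (x t)‖]
  rw [tendsto_zero_iff_norm_tendsto_zero]
  simpa using hsq.sqrt

theorem tendsto_smul_dot (h : DampedMonotoneFlow Q t₀ α η ε β x) {z : H} (hz : Q z = 0)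
    (hε : 0 < ε) : Tendsto (fun t => t • dot t₀ x t) atTop (𝓝 0) := by
  have hc := mul_pos h.η_mem.1 (sub_pos.2 h.η_mem.2)
  have hsq : Tendsto (fun t => ‖t • dot t₀ x t + ((1 - η) * (t * β t)) • Q (x t)‖ ^ 2)
      atTop (𝓝 0) := by
    refine squeeze_zero (fun _ => sq_nonneg _) (fun t => ?_)
      (by simpa using (h.tendsto_kineticEnergy hz hε).const_mul 2)
    have : 0 ≤ η * (1 - η) * ‖(t * β t) • Q (x t)‖ ^ 2 := by positivity
    rw [kineticEnergy]
    linarith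
  have hP : Tendsto (fun t => t • dot t₀ x t + ((1 - η) * (t * β t)) • Q (x t)) atTop (𝓝 0) := by
    rw [tendsto_zero_iff_norm_tendsto_zero]
    simpa using hsq.sqrt
  have := hP.sub ((h.tendsto_smul_Q hz hε).const_smul (1 - η))
  simpa [smul_smul] using this

/-- The coupling term is the difference quotient of two convergent Lyapunov functions in the
parameter `lam`. -/
theorem exists_tendsto_coupling (h : DampedMonotoneFlow Q t₀ α η ε β x) {z : H} (hz : Q z = 0)
    (hε : 0 < ε) : ∃ L, Tendsto
      (fun t => coupling α t (β t) (x t - z) (dot t₀ x t) (Q (x t))) atTop (𝓝 L) := by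
  have hc : α - 1 ≠ 0 := by linarith [h.two_le_α]
  obtain ⟨L, hL⟩ := exists_tendsto_of_sub_le_integral (fun t ht => h.lyapunov_nonneg hz ht)
    continuousOn_const integrableOn_zero (fun s t hs hst => h.lyapunov_antitone hz hs hst)
  refine ⟨_, ((hL.sub (h.tendsto_kineticEnergy hz hε)).div_const (α - 1)).congr fun t => ?_⟩
  rw [lyapunov, add_sub_cancel_left, mul_div_cancel_left₀ _ hc]

end DampedMonotoneFlow

/-- If `κ ‖y‖²` converges up to the scalar product of `y` with a null function, then `y` stays
bounded. -/
theorem eventually_norm_le_of_tendsto_inner_add {ι : Type*} {l : Filter ι} {y g : ι → H}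
    {κ L : ℝ} (hκ : 0 < κ) (hg : Tendsto g l (𝓝 0))
    (h : Tendsto (fun i => ⟪y i, g i⟫ + κ * ‖y i‖ ^ 2) l (𝓝 L)) :
    ∃ R, ∀ᶠ i in l, ‖y i‖ ≤ R := by
  -- Once `‖g‖ ≤ κ / 2`, the sum is at least `κ / 2 * (2 ‖y‖² - ‖y‖)`, and `2 r² - r ≥ r - 1 / 2`.
  refine ⟨2 * (L + 1) / κ + 1 / 2, ?_⟩
  filter_upwards [h.eventually (gt_mem_nhds (lt_add_one L)),
    (tendsto_zero_iff_norm_tendsto_zero.1 hg).eventually (gt_mem_nhds (half_pos hκ))] with i h1 h2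
  have h3 := neg_le_of_abs_le (abs_real_inner_le_norm (y i) (g i))
  have h4 := mul_le_mul_of_nonneg_left h2.le (norm_nonneg (y i))
  have h5 : ‖y i‖ - 1 / 2 ≤ 2 * (L + 1) / κ := by
    rw [le_div_iff₀ hκ]
    nlinarith [mul_nonneg hκ.le (sq_nonneg (‖y i‖ - 1 / 2))]
  linarith

theorem tendsto_inner_zero_of_bounded {ι : Type*} {l : Filter ι} {y g : ι → H} {R : ℝ}
    (hy : ∀ᶠ i in l, ‖y i‖ ≤ R) (hg : Tendsto g l (𝓝 0)) :
    Tendsto (fun i => ⟪y i, g i⟫) l (𝓝 0) := by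
  have hb : Tendsto (fun i => R * ‖g i‖) l (𝓝 0) := by
    simpa using (tendsto_zero_iff_norm_tendsto_zero.1 hg).const_mul R
  refine squeeze_zero_norm' ?_ hb
  filter_upwards [hy] with i hi
  exact (norm_inner_le_norm _ _).trans (by gcongr)

theorem isLittleO_one_div {f w : ℝ → ℝ} (hw : ∀ᶠ t in atTop, 0 < w t)
    (hf : Tendsto (fun t => w t * f t) atTop (𝓝 0)) : f =o[atTop] (fun t => 1 / w t) := by
  refine (isLittleO_iff_tendsto' ?_).2 (hf.congr' ?_)
  · filter_upwards [hw] with t ht h0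
    exact absurd h0 (one_div_pos.2 ht).ne'
  · filter_upwards [hw] with t ht
    rw [div_div_eq_mul_div, div_one, mul_comm]

namespace DampedMonotoneFlow

variable {Q : H → H} {t₀ α η ε : ℝ} {β : ℝ → ℝ} {x : ℝ → H}

theorem exists_bound_and_tendsto (h : DampedMonotoneFlow Q t₀ α η ε β x) {z : H} (hz : Q z = 0)
    (hε : 0 < ε) : (∃ R, ∀ᶠ t in atTop, ‖x t - z‖ ≤ R) ∧
      ∃ L, Tendsto (fun t => ‖x t - z‖ ^ 2) atTop (𝓝 L) := by
  have hκ : 0 < 1 / 2 * (α - 1) := by linarith [h.two_le_α]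
  have hg : Tendsto (fun t => t • dot t₀ x t + (t * β t) • Q (x t)) atTop (𝓝 0) := by
    simpa using (h.tendsto_smul_dot hz hε).add (h.tendsto_smul_Q hz hε)
  obtain ⟨L, hL⟩ := h.exists_tendsto_coupling hz hε
  obtain ⟨R, hR⟩ := eventually_norm_le_of_tendsto_inner_add hκ hg hL
  refine ⟨⟨R, hR⟩, _, ((hL.sub (tendsto_inner_zero_of_bounded hR hg)).div_const
    (1 / 2 * (α - 1))).congr fun t => ?_⟩
  rw [coupling, add_sub_cancel_left, mul_div_cancel_left₀ _ hκ.ne']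

theorem tendsto_Q (h : DampedMonotoneFlow Q t₀ α η ε β x) {z : H} (hz : Q z = 0)
    (hε : 0 < ε) : Tendsto (fun t => Q (x t)) atTop (𝓝 0) := by
  have hc : 0 < t₀ * β t₀ := mul_pos h.t₀_pos (h.β_pos t₀ le_rfl)
  have hb := (tendsto_zero_iff_norm_tendsto_zero.1 (h.tendsto_smul_Q hz hε)).const_mul
    (t₀ * β t₀)⁻¹
  rw [mul_zero] at hb
  refine squeeze_zero_norm' ?_ hb
  filter_upwards [eventually_ge_atTop t₀] with t ht
  have htβ : t₀ * β t₀ ≤ t * β t :=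
    mul_le_mul ht (h.β_ge ht) (h.β_pos t₀ le_rfl).le (h.t₀_pos.le.trans ht)
  rw [le_inv_mul_iff₀ hc, norm_smul, Real.norm_of_nonneg (hc.le.trans htβ)]
  gcongr

theorem exists_weak_limit [CompleteSpace H] (h : DampedMonotoneFlow Q t₀ α η ε β x) {z : H}
    (hz : Q z = 0) (hε : 0 < ε) : ∃ w : H, Q w = 0 ∧
      Tendsto (fun t => toWeakSpace ℝ H (x t)) atTop (𝓝 (toWeakSpace ℝ H w)) := by
  refine exists_weak_limit_of_opial (S := {w | Q w = 0}) ⟨z, hz⟩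
    (fun w hw => (h.exists_bound_and_tendsto hw hε).2) fun U hU w hw => ?_
  obtain ⟨⟨R, hR⟩, -⟩ := h.exists_bound_and_tendsto hz hε
  have hR' : ∀ᶠ t in atTop, ‖x t‖ ≤ R + ‖z‖ := by
    filter_upwards [hR] with t ht
    exact (norm_le_norm_sub_add _ z).trans (by gcongr)
  obtain ⟨K, hK⟩ := h.lipschitz
  exact h.mono.eq_zero_of_weak_limit hK.continuous (hU hR') ((h.tendsto_Q hz hε).mono_left hU) hw

theorem eventually_weight_pos (h : DampedMonotoneFlow Q t₀ α η ε β x) :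
    ∀ᶠ t in atTop, 0 < t * β t := by
  filter_upwards [eventually_ge_atTop t₀] with t ht
  exact mul_pos (h.t₀_pos.trans_le ht) (h.β_pos t ht)

theorem isLittleO_inner (h : DampedMonotoneFlow Q t₀ α η ε β x) {z : H} (hz : Q z = 0)
    (hε : 0 < ε) :
    (fun t => ⟪Q (x t), x t - z⟫) =o[atTop] (fun t => 1 / (t * β t)) := by
  obtain ⟨⟨R, hR⟩, -⟩ := h.exists_bound_and_tendsto hz hε
  refine isLittleO_one_div h.eventually_weight_pos
    ((tendsto_inner_zero_of_bounded hR (h.tendsto_smul_Q hz hε)).congr fun t => ?_)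
  rw [inner_smul_right, real_inner_comm]

theorem isLittleO_norm (h : DampedMonotoneFlow Q t₀ α η ε β x) {z : H} (hz : Q z = 0)
    (hε : 0 < ε) : (fun t => ‖Q (x t)‖) =o[atTop] (fun t => 1 / (t * β t)) := by
  refine isLittleO_one_div h.eventually_weight_pos
    ((tendsto_zero_iff_norm_tendsto_zero.1 (h.tendsto_smul_Q hz hε)).congr' ?_)
  filter_upwards [h.eventually_weight_pos] with t ht
  rw [norm_smul, Real.norm_of_nonneg ht.le]

theorem isLittleO_dot (h : DampedMonotoneFlow Q t₀ α η ε β x) {z : H} (hz : Q z = 0)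
    (hε : 0 < ε) : (fun t => ‖dot t₀ x t‖) =o[atTop] (fun t => 1 / t) := by
  refine isLittleO_one_div (eventually_gt_atTop 0)
    ((tendsto_zero_iff_norm_tendsto_zero.1 (h.tendsto_smul_dot hz hε)).congr' ?_)
  filter_upwards [eventually_gt_atTop (0 : ℝ)] with t ht
  rw [norm_smul, Real.norm_of_nonneg ht.le]

end DampedMonotoneFlow

end Flow

theorem mainTheorem2 {H : Type*} [NormedAddCommGroup H] [InnerProductSpace ℝ H] [CompleteSpace H]
    (Q : H → H) (hQmono : IsMonotoneOperator Q) (hQlip : ∃ K : ℝ≥0, LipschitzWith K Q)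
    (xs : H) (hxs : Q xs = 0)
    (t₀ α η ε : ℝ) (ht₀ : 0 < t₀) (hα : 2 ≤ α) (hη : η ∈ Ioo (0 : ℝ) 1) (hε : 0 ≤ ε)
    (β : ℝ → ℝ) (hβpos : ∀ t : ℝ, t₀ ≤ t → 0 < β t) (hβdiff : DifferentiableOn ℝ β (Ici t₀))
    (hβgrowth : GrowthCondition t₀ α ε β)
    (x : ℝ → H) (hx : IsStrongSolution Q t₀ α η β x) :
    ((fun t => ⟪Q (x t), x t - xs⟫) =O[atTop] (fun t => 1 / (t * β t)) ∧
      (fun t => ‖Q (x t)‖) =O[atTop] (fun t => 1 / (t * β t))) ∧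
    (2 < α → 0 < ε →
      (IntegrableOn (fun t => β t * ⟪Q (x t), x t - xs⟫) (Ici t₀) ∧
        IntegrableOn (fun t => t * β t ^ 2 * ‖Q (x t)‖ ^ 2) (Ici t₀) ∧
        IntegrableOn (fun t => t * ‖dot t₀ x t‖ ^ 2) (Ici t₀)) ∧
      (∃ z : H, Q z = 0 ∧
        Tendsto (fun t => toWeakSpace ℝ H (x t)) atTop (𝓝 (toWeakSpace ℝ H z))) ∧
      ((fun t => ⟪Q (x t), x t - xs⟫) =o[atTop] (fun t => 1 / (t * β t)) ∧
        (fun t => ‖Q (x t)‖) =o[atTop] (fun t => 1 / (t * β t)) ∧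
        (fun t => ‖dot t₀ x t‖) =o[atTop] (fun t => 1 / t))) := by
  have h : DampedMonotoneFlow Q t₀ α η ε β x :=
    ⟨hQmono, hQlip, ht₀, hα, hη, hε, hβpos, hβdiff, hβgrowth, hx⟩
  refine ⟨⟨h.isBigO_inner hxs, h.isBigO_norm hxs⟩, fun _ hε' => ⟨⟨?_, ?_, ?_⟩, ?_, ?_, ?_, ?_⟩⟩
  · exact h.integrableOn_inner hxs hε'
  · exact h.integrableOn_norm_Q hxs hε'
  · exact h.integrableOn_norm_dot hxs hε'
  · exact h.exists_weak_limit hxs hε'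
  · exact h.isLittleO_inner hxs hε'
  · exact h.isLittleO_norm hxs hε'
  · exact h.isLittleO_dot hxs hε'
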